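/- Definitions. A tournament $T=(V,E)$ is a set $V$ of vertices (possibly empty) with an irreflexive, antisymmetric and complete binary relation $E$ on $V$; it is finite of size $m$ if $|V|=m$. A subtournament is the restriction of $T$ to a set of vertices. A tournament is acyclic if it contains no $3$-element cycle. A set $A\subseteq V$ is autonomous if for all $x,x'\in A$ and $y\notin A$: $(x,y)\in E$ if and only if $(x',y)\in E$. $T$ is acyclically indecomposable if no acyclic autonomous set of vertices has more than one element. For a vertex $x$, the acyclic component of $x$ is the union of all acyclic autonomous sets containing $x$ (it is the largest such set); the acyclic components partition $V$, and $\check T$ denotes the tournament whose vertices are the acyclic components of $T$, with an edge from a component $P$ to a different component $Q$ if $(x,y)\in E$ for some (equivalently, all) $x\in P$, $y\in Q$. For an acyclic tournament $C=(A,<)$, let $\mathfrak B_C:=\{C_{3[C]},V_{[C]},T_{[C]},U_{[C]},H_{[C]},K_{[C]}\}$, where: - $C_{3[C]}$ is the lexicographical sum, indexed by $C$, of copies of the $3$-cycle (each $x\in A$ is replaced by a $3$-cycle, and all edges go from the copy at $x$ to the copy at $y$ when $x<y$); - $V_{[C]}$ has vertex set $(A\times\{0,1\})\cup\{a\}$ with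 $a\notin A\times\{0,1\}$; its edges are the pairs $((x,i),(x',i'))$ with $x<x'$, or with $x=x'$ and $i<i'$, and the pairs $(a,(x,0))$ and $((x,1),a)$ for all $x\in A$; - $T_{[C]},U_{[C]},H_{[C]},K_{[C]}$ have vertex set $A\times\{0,1\}$. In each of them, $(x,0)\to(x,1)$ for all $x\in A$, and $(x,0)\to(y,0)$ whenever $x<y$. The remaining edges are, for all $x<y$ in $A$: - in $T_{[C]}$: $(y,1)\to(x,0)$, $(y,0)\to(x,1)$, $(x,1)\to(y,1)$; - in $U_{[C]}$: $(x,0)\to(y,1)$, $(x,1)\to(y,0)$, $(y,1)\to(x,1)$; - in $H_{[C]}$: $(y,1)\to(x,0)$, $(x,1)\to(y,0)$, $(x,1)\to(y,1)$; - in $K_{[C]}$: $(y,1)\to(x,0)$, $(x,1)\to(y,0)$, $(y,1)\to(x,1)$. For a non-negative integer $n$ let $\underline n$ be the acyclic tournament on $\{0,\dots,n-1\}$ given by the natural strict order, and let $\check{\mathfrak B}_{\underline n}:=\{\check T: T\in\mathfrak B_{\underline n}\}$. Theorem. For every non-negative integer $n$ there is an integer $a(n)$ such that every finite tournament of size at least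 $a(n)$ which is acyclically indecomposable contains a subtournament isomorphic to a member of $\check{\mathfrak B}_{\underline n}$. -/

import Mathlib

universe u v

/-- A tournament on the vertex set `V`: a digraph (`Adj x y` means that `(x, y)` is an edge) whose
edge relation is irreflexive, antisymmetric and complete. The vertex set may be empty. -/
structure Tournament (V : Type u) extends Digraph V where
  irrefl : ∀ x, ¬ Adj x x
  antisymm : ∀ x y, Adj x y → Adj y x → x = y
  complete : ∀ x y, x ≠ y → Adj x y ∨ Adj y x

namespace Tournament

variable {V : Type u} {W : Type v}

theorem asymm (T : Tournament V) {x y : V} (h : T.Adj x y) : ¬ T.Adj y x := by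
  intro h'
  have := T.antisymm x y h h'
  subst this
  exact T.irrefl _ h

/-- The tournament induced on a set `S` of vertices. -/
def restrict (T : Tournament V) (S : Set V) : Tournament S where
  Adj x y := T.Adj x y
  irrefl x := T.irrefl x
  antisymm x y h h' := Subtype.ext (T.antisymm x y h h')
  complete x y h := T.complete x y (fun e => h (Subtype.ext e))

/-- `T` and `T'` are isomorphic. -/
def IsIsomorphicTo (T : Tournament V) (T' : Tournament W) : Prop :=
  Nonempty (T.Adj ≃r T'.Adj)

/-- `T` is embeddable into `T'`: it is isomorphic to a subtournament of `T'`. -/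
def IsEmbeddableInto (T : Tournament V) (T' : Tournament W) : Prop :=
  ∃ S : Set W, T.IsIsomorphicTo (T'.restrict S)

/-- `T` is acyclic: it contains no 3-element cycle. -/
def IsAcyclic (T : Tournament V) : Prop :=
  ∀ x y z : V, ¬ (T.Adj x y ∧ T.Adj y z ∧ T.Adj z x)

/-- A set `A` of vertices is autonomous if no vertex outside `A` distinguishes two vertices
of `A`. -/
def IsAutonomous (T : Tournament V) (A : Set V) : Prop :=
  ∀ x ∈ A, ∀ x' ∈ A, ∀ y ∉ A, (T.Adj x y ↔ T.Adj x' y)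

/-- No acyclic autonomous set of vertices has more than one element. -/
def IsAcyclicallyIndecomposable (T : Tournament V) : Prop :=
  ∀ A : Set V, T.IsAutonomous A → (T.restrict A).IsAcyclic → A.Subsingleton

/-! ### Acyclic components and the tournament indexing them -/

/-- The union of all acyclic autonomous sets of vertices that contain `x`. -/
def acyclicComponent (T : Tournament V) (x : V) : Set V :=
  ⋃₀ {A | T.IsAutonomous A ∧ (T.restrict A).IsAcyclic ∧ x ∈ A}

/-- The set of all acyclic components of `T`. -/
def acyclicComponents (T : Tournament V) : Set (Set V) :=
  Set.range T.acyclicComponent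

theorem IsAutonomous.adj_iff {T : Tournament V} {A : Set V} (hA : T.IsAutonomous A)
    {x x' y : V} (hx : x ∈ A) (hx' : x' ∈ A) (hy : y ∉ A) : T.Adj y x ↔ T.Adj y x' := by
  have h := hA x hx x' hx' y hy
  have aux : ∀ z ∈ A, (T.Adj y z ↔ ¬ T.Adj z y) := fun z hz =>
    ⟨fun h => T.asymm h, fun h =>
      (T.complete y z (fun e => hy (e ▸ hz))).resolve_right h⟩
  rw [aux x hx, aux x' hx', h]

theorem IsAutonomous.union {T : Tournament V} {A B : Set V} (hA : T.IsAutonomous A)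
    (hB : T.IsAutonomous B) {z : V} (hzA : z ∈ A) (hzB : z ∈ B) : T.IsAutonomous (A ∪ B) := by
  have key : ∀ x ∈ A ∪ B, ∀ y ∉ A ∪ B, (T.Adj x y ↔ T.Adj z y) := by
    rintro x (hx | hx) y hy
    · exact hA x hx z hzA y (fun h => hy (Or.inl h))
    · exact hB x hx z hzB y (fun h => hy (Or.inr h))
  intro x hx x' hx' y hy
  rw [key x hx y hy, key x' hx' y hy]

theorem isAcyclic_restrict_union {T : Tournament V} {A B : Set V} (hA : T.IsAutonomous A)
    (hB : T.IsAutonomous B) (hA' : (T.restrict A).IsAcyclic) (hB' : (T.restrict B).IsAcyclic) :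
    (T.restrict (A ∪ B)).IsAcyclic := by
  -- a 3-cycle with two vertices in an acyclic autonomous set is impossible
  have key : ∀ D : Set V, T.IsAutonomous D → (T.restrict D).IsAcyclic → ∀ x ∈ D, ∀ y ∈ D, ∀ z,
      T.Adj x y → T.Adj y z → T.Adj z x → False := by
    intro D hD hD' x hx y hy z h1 h2 h3
    by_cases hz : z ∈ D
    · exact hD' ⟨x, hx⟩ ⟨y, hy⟩ ⟨z, hz⟩ ⟨h1, h2, h3⟩
    · exact T.asymm h3 ((hD x hx y hy z hz).2 h2)
  rintro ⟨x, hx⟩ ⟨y, hy⟩ ⟨z, hz⟩ ⟨h1, h2, h3⟩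
  have h1 : T.Adj x y := h1
  have h2 : T.Adj y z := h2
  have h3 : T.Adj z x := h3
  rcases hx with hx | hx <;> rcases hy with hy | hy <;> rcases hz with hz | hz
  · exact key A hA hA' x hx y hy z h1 h2 h3
  · exact key A hA hA' x hx y hy z h1 h2 h3
  · exact key A hA hA' z hz x hx y h3 h1 h2
  · exact key B hB hB' y hy z hz x h2 h3 h1
  · exact key A hA hA' y hy z hz x h2 h3 h1
  · exact key B hB hB' z hz x hx y h3 h1 h2
  · exact key B hB hB' x hx y hy z h1 h2 h3
  · exact key B hB hB' x hx y hy z h1 h2 h3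

theorem mem_acyclicComponent_self (T : Tournament V) (x : V) : x ∈ T.acyclicComponent x := by
  refine ⟨{x}, ⟨?_, ?_, rfl⟩, rfl⟩
  · rintro a rfl b rfl y _
    rfl
  · rintro ⟨a, ha⟩ ⟨b, hb⟩ ⟨c, hc⟩ ⟨h, -, -⟩
    have h : T.Adj a b := h
    rw [Set.mem_singleton_iff.1 ha, Set.mem_singleton_iff.1 hb] at h
    exact T.irrefl _ h

theorem isAutonomous_acyclicComponent (T : Tournament V) (x : V) :
    T.IsAutonomous (T.acyclicComponent x) := by
  have key : ∀ a ∈ T.acyclicComponent x, ∀ y ∉ T.acyclicComponent x,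
      (T.Adj a y ↔ T.Adj x y) := by
    rintro a ⟨A, hA, haA⟩ y hy
    exact hA.1 a haA x hA.2.2 y (fun h => hy ⟨A, hA, h⟩)
  intro a ha b hb y hy
  rw [key a ha y hy, key b hb y hy]

theorem acyclicComponent_eq_of_mem (T : Tournament V) {x y : V}
    (h : y ∈ T.acyclicComponent x) : T.acyclicComponent y = T.acyclicComponent x := by
  obtain ⟨A, ⟨hA1, hA2, hxA⟩, hyA⟩ := h
  apply Set.Subset.antisymm
  · rintro z ⟨B, ⟨hB1, hB2, hyB⟩, hzB⟩
    exact ⟨A ∪ B, ⟨hA1.union hB1 hyA hyB, isAcyclic_restrict_union hA1 hB1 hA2 hB2, Or.inl hxA⟩,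
      Or.inr hzB⟩
  · rintro z ⟨B, ⟨hB1, hB2, hxB⟩, hzB⟩
    exact ⟨A ∪ B, ⟨hA1.union hB1 hxA hxB, isAcyclic_restrict_union hA1 hB1 hA2 hB2, Or.inl hyA⟩,
      Or.inr hzB⟩

/-- Edges between distinct acyclic components do not depend on the chosen vertices. -/
theorem adj_iff_of_acyclicComponent_eq (T : Tournament V) {x x' y y' : V}
    (hx : T.acyclicComponent x = T.acyclicComponent x')
    (hy : T.acyclicComponent y = T.acyclicComponent y')
    (hxy : T.acyclicComponent x ≠ T.acyclicComponent y) : T.Adj x y ↔ T.Adj x' y' := by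
  have h1 : y ∉ T.acyclicComponent x := fun h => hxy (T.acyclicComponent_eq_of_mem h).symm
  have h2 : x' ∉ T.acyclicComponent y := fun h =>
    hxy (hx.trans (T.acyclicComponent_eq_of_mem h))
  rw [T.isAutonomous_acyclicComponent x x (T.mem_acyclicComponent_self x) x'
      (hx ▸ T.mem_acyclicComponent_self x') y h1,
    (T.isAutonomous_acyclicComponent y).adj_iff (T.mem_acyclicComponent_self y)
      (hy ▸ T.mem_acyclicComponent_self y') h2]

/-- The tournament indexing the acyclic components of `T`: its vertices are the acyclic components
of `T`, and its edges are the pairs of distinct components of `x` and of `y`, where `(x, y)` is an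
edge of `T`. -/
def check (T : Tournament V) : Tournament T.acyclicComponents where
  Adj P Q := P ≠ Q ∧
    ∃ x y : V, P.1 = T.acyclicComponent x ∧ Q.1 = T.acyclicComponent y ∧ T.Adj x y
  irrefl P h := h.1 rfl
  antisymm P Q := by
    rintro ⟨hPQ, x, y, hx, hy, h⟩ ⟨-, y', x', hy', hx', h'⟩
    have hne : T.acyclicComponent x ≠ T.acyclicComponent y := fun e =>
      hPQ (Subtype.ext (hx.trans (e.trans hy.symm)))
    exact absurd h' (T.asymm
      ((T.adj_iff_of_acyclicComponent_eq (hx.symm.trans hx') (hy.symm.trans hy') hne).1 h))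
  complete := by
    rintro ⟨_, x, rfl⟩ ⟨_, y, rfl⟩ hne
    have hxy : x ≠ y := by
      rintro rfl
      exact hne rfl
    rcases T.complete x y hxy with h | h
    · exact Or.inl ⟨hne, x, y, rfl, rfl, h⟩
    · exact Or.inr ⟨hne.symm, y, x, rfl, rfl, h⟩

/-! ### The six tournaments attached to an acyclic tournament

The constructions below make sense for, and are written for, any tournament `C`. -/

/-- The acyclic tournament on `{0, …, n - 1}` given by the natural strict order. -/
def linear (n : ℕ) : Tournament (Fin n) where
  Adj x y := x < y
  irrefl x := lt_irrefl x
  antisymm _ _ h h' := absurd h' (lt_asymm h)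
  complete _ _ h := lt_or_gt_of_ne h

/-- The 3-cycle `0 → 1 → 2 → 0`. -/
def cycle3 : Tournament (Fin 3) where
  Adj x y := y = x + 1
  irrefl := by decide
  antisymm := by decide
  complete := by decide

/-- The lexicographical sum of the tournaments `T i` indexed by the tournament `D`. -/
def lexSum {I : Type u} {V : I → Type v} (D : Tournament I) (T : ∀ i, Tournament (V i)) :
    Tournament (Σ i, V i) where
  Adj p q := D.Adj p.1 q.1 ∨ ∃ h : p.1 = q.1, (T q.1).Adj (h ▸ p.2) q.2
  irrefl := by
    rintro ⟨i, x⟩ (h | ⟨_, h⟩)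
    · exact D.irrefl _ h
    · exact (T i).irrefl _ h
  antisymm := by
    rintro ⟨i, x⟩ ⟨j, y⟩ (h | ⟨e, h⟩) (h' | ⟨e', h'⟩)
    · exact absurd h' (D.asymm h)
    · dsimp only at e'
      subst e'
      exact absurd h (D.irrefl _)
    · dsimp only at e
      subst e
      exact absurd h' (D.irrefl _)
    · dsimp only at e
      subst e
      exact absurd h' ((T i).asymm h)
  complete := by
    rintro ⟨i, x⟩ ⟨j, y⟩ hne
    by_cases e : i = j
    · subst e
      have hxy : x ≠ y := by
        rintro rfl
        exact hne rfl
      exact ((T i).complete x y hxy).imp (fun h => Or.inr ⟨rfl, h⟩) (fun h => Or.inr ⟨rfl, h⟩)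
    · exact (D.complete i j e).imp Or.inl Or.inl

/-- `C₃[C]`: the lexicographical product `C₃.C`, that is, the lexicographical sum indexed by `C` of
copies of the 3-cycle. -/
def C3 (C : Tournament V) : Tournament (Σ _ : V, Fin 3) :=
  lexSum C (fun _ => cycle3)

/-- The edge relation of `V[C]`; the extra vertex `a` is `none`. -/
def VAdj (C : Tournament V) : Option (V × Fin 2) → Option (V × Fin 2) → Prop
  | some (x, i), some (x', i') => C.Adj x x' ∨ (x = x' ∧ i < i')
  | none, some (_, i') => i' = 0
  | some (_, i), none => i = 1
  | none, none => False

/-- `V[C]`: the lexicographical product of the 2-element tournament by `C`, with an additional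
vertex `a` such that `a → (x, 0)` and `(x, 1) → a` for all `x`. -/
def VT (C : Tournament V) : Tournament (Option (V × Fin 2)) where
  Adj := C.VAdj
  irrefl := by
    rintro (_ | ⟨x, i⟩) h
    · exact h
    · rcases h with h | ⟨_, h⟩
      · exact C.irrefl _ h
      · exact lt_irrefl _ h
  antisymm := by
    rintro (_ | ⟨x, i⟩) (_ | ⟨y, j⟩) h h'
    · rfl
    · simp only [VAdj] at h h'
      omega
    · simp only [VAdj] at h h'
      omega
    · exfalso
      rcases h with h | ⟨e, h⟩ <;> rcases h' with h' | ⟨e', h'⟩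
      · exact C.asymm h h'
      · exact C.irrefl _ (e' ▸ h)
      · exact C.irrefl _ (e ▸ h')
      · exact lt_asymm h h'
  complete := by
    rintro (_ | ⟨x, i⟩) (_ | ⟨y, j⟩) hne
    · exact absurd rfl hne
    · simp only [VAdj]
      omega
    · simp only [VAdj]
      omega
    · by_cases e : x = y
      · subst e
        have hij : i ≠ j := by
          rintro rfl
          exact hne rfl
        exact (lt_or_gt_of_ne hij).imp (fun h => Or.inr ⟨rfl, h⟩) (fun h => Or.inr ⟨rfl, h⟩)
      · exact (C.complete x y e).imp Or.inl Or.inl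

/-- Pairs of elements of `2 × 2`, where `2 = {0, 1}`. -/
abbrev Pair : Type := (Fin 2 × Fin 2) × (Fin 2 × Fin 2)

/-- `h i = ((0, i), (1, i))`. -/
def h (i : Fin 2) : Pair := ((0, i), (1, i))

/-- `v i = ((i, 0), (i, 1))`. -/
def v (i : Fin 2) : Pair := ((i, 0), (i, 1))

/-- `d i = ((0, i), (1, i + 1))`, with `i + 1` taken modulo 2. -/
def d (i : Fin 2) : Pair := ((0, i), (1, i + 1))

/-- The directed graph `Δ(C, X)` on `V × {0, 1}`. -/
def Delta (C : Tournament V) (X : Finset Pair) : Digraph (V × Fin 2) where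
  Adj p q :=
    (p.1 = q.1 ∧ ((0, p.2), (0, q.2)) ∈ X) ∨
    (C.Adj p.1 q.1 ∧ ((0, p.2), (1, q.2)) ∈ X) ∨
    (C.Adj q.1 p.1 ∧ ((1, p.2), (0, q.2)) ∈ X)

/-- The condition on `X` under which `Δ(C, X)` is a tournament. -/
def IsGood (X : Finset Pair) : Prop :=
  (∀ i j : Fin 2, ((0, i), (0, j)) ∈ X ↔ (i ≠ j ∧ ((0, j), (0, i)) ∉ X)) ∧
  (∀ i j : Fin 2, ((0, i), (1, j)) ∈ X ↔ ((1, j), (0, i)) ∉ X)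

instance (X : Finset Pair) : Decidable (IsGood X) := by
  unfold IsGood
  infer_instance

/-- `Δ(C, X)` as a tournament. -/
def deltaTournament (C : Tournament V) (X : Finset Pair) (hX : IsGood X) :
    Tournament (V × Fin 2) where
  toDigraph := C.Delta X
  irrefl := by
    rintro ⟨x, i⟩ (⟨_, h⟩ | ⟨h, _⟩ | ⟨h, _⟩)
    · exact ((hX.1 i i).1 h).1 rfl
    · exact C.irrefl _ h
    · exact C.irrefl _ h
  antisymm := by
    rintro ⟨x, i⟩ ⟨y, j⟩ h h'
    exfalso
    simp only [Delta] at h h'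
    rcases h with ⟨e, h⟩ | ⟨e, h⟩ | ⟨e, h⟩ <;> rcases h' with ⟨e', h'⟩ | ⟨e', h'⟩ | ⟨e', h'⟩
    · exact ((hX.1 i j).1 h).2 h'
    · exact C.irrefl _ (e ▸ e')
    · exact C.irrefl _ (e ▸ e')
    · exact C.irrefl _ (e' ▸ e)
    · exact C.asymm e e'
    · exact (hX.2 i j).1 h h'
    · exact C.irrefl _ (e' ▸ e)
    · exact (hX.2 j i).1 h' h
    · exact C.asymm e e'
  complete := by
    rintro ⟨x, i⟩ ⟨y, j⟩ hne
    simp only [Delta]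
    by_cases e : x = y
    · subst e
      have hij : i ≠ j := by
        rintro rfl
        exact hne rfl
      by_cases h : ((0, j), (0, i)) ∈ X
      · exact Or.inr (Or.inl ⟨rfl, h⟩)
      · exact Or.inl (Or.inl ⟨rfl, (hX.1 i j).2 ⟨hij, h⟩⟩)
    · rcases C.complete x y e with h | h
      · by_cases h' : ((1, j), (0, i)) ∈ X
        · exact Or.inr (Or.inr (Or.inr ⟨h, h'⟩))
        · exact Or.inl (Or.inr (Or.inl ⟨h, (hX.2 i j).2 h'⟩))
      · by_cases h' : ((1, i), (0, j)) ∈ X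
        · exact Or.inl (Or.inr (Or.inr ⟨h, h'⟩))
        · exact Or.inr (Or.inr (Or.inl ⟨h, (hX.2 j i).2 h'⟩))

/-- `T[C]`. -/
def TT (C : Tournament V) : Tournament (V × Fin 2) :=
  C.deltaTournament {(d 0).swap, (d 1).swap, h 1, h 0, v 0} (by decide)

/-- `U[C]`. -/
def UT (C : Tournament V) : Tournament (V × Fin 2) :=
  C.deltaTournament {d 0, d 1, (h 1).swap, h 0, v 0} (by decide)

/-- `H[C]`. -/
def HT (C : Tournament V) : Tournament (V × Fin 2) :=
  C.deltaTournament {(d 0).swap, d 1, h 1, h 0, v 0} (by decide)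

/-- `K[C]`. -/
def KT (C : Tournament V) : Tournament (V × Fin 2) :=
  C.deltaTournament {(d 0).swap, d 1, (h 1).swap, h 0, v 0} (by decide)

/-- The set `𝔅_C` consisting of the six tournaments attached to `C`. A tournament is bundled with
its type of vertices. -/
def familyB (C : Tournament V) : Set (Σ W : Type u, Tournament W) :=
  {⟨_, C.C3⟩, ⟨_, C.VT⟩, ⟨_, C.TT⟩, ⟨_, C.UT⟩, ⟨_, C.HT⟩, ⟨_, C.KT⟩}

/-- The set `{Ť : T ∈ 𝔅_C}`. -/
def checkFamilyB (C : Tournament V) : Set (Σ W : Type u, Tournament W) :=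
  (fun T => ⟨T.2.acyclicComponents, T.2.check⟩) '' C.familyB

end Tournament

namespace Tournament

/-! An edge-preserving map between tournaments is injective, and `B.check` is a subtournament of
`B`, so it suffices to map some member of the family to `T` preserving edges (`ContainsFamilyB`).

A large tournament contains a long transitive chain; cut it into consecutive pairs x_i → y_i. The
set formed by x_i, y_i and the vertices between them is not both acyclic and autonomous, and
`exists_witness` turns this failure into at most three vertices attached to the pair: a return path
y → u → x, a 3-cycle between x and y, or a vertex z between them with a return path over (x, z) or
over (z, y). Ramsey's theorem makes the type of witness constant and the chain and witness sequences
mutually homogeneous.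

For two homogeneous monotone sequences with p_i → q_i, at least one of them increasing, a finite
case check (`full_or_block_of_fwd_left`, `full_or_block_of_fwd_right`) gives one of T, U, H, K, or
all edges from p to q (`Full`), or a transitive interleaving (`Block`). Applied to the sides of the
witness triangles, a `Full` side supplies a single vertex serving as the apex of V, while three
`Block` sides form C₃. A constant witness sequence also gives an apex of V. -/

/-- `B.check` is realised on a set of representatives of the acyclic components of `B`, so a map
from `B` preserving edges yields an embedding of `B.check`. -/
theorem check_isEmbeddableInto_of_hom {V : Type u} {W : Type v} {B : Tournament W}
    {T : Tournament V} (f : W → V) (hf : ∀ a b, B.Adj a b → T.Adj (f a) (f b)) :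
    B.check.IsEmbeddableInto T := by
  choose r hr using fun P : B.acyclicComponents => P.2
  have hom : ∀ P Q, B.check.Adj P Q → T.Adj (f (r P)) (f (r Q)) := by
    rintro P Q ⟨hne, x, y, hx, hy, hxy⟩
    have hne' : B.acyclicComponent x ≠ B.acyclicComponent y := fun e =>
      hne (Subtype.ext (hx.trans (e.trans hy.symm)))
    exact hf _ _ ((B.adj_iff_of_acyclicComponent_eq (hx.symm.trans (hr P).symm)
      (hy.symm.trans (hr Q).symm) hne').1 hxy)
  -- Two vertices with the same image would turn the edge between them into a loop of `T`.
  have inj : Function.Injective fun P => f (r P) := by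
    intro P Q h
    by_contra hne
    rcases B.check.complete P Q hne with h' | h'
    · have := hom _ _ h'
      rw [show f (r P) = f (r Q) from h] at this
      exact T.irrefl _ this
    · have := hom _ _ h'
      rw [show f (r P) = f (r Q) from h] at this
      exact T.irrefl _ this
  refine ⟨Set.range fun P => f (r P), ⟨⟨Equiv.ofInjective _ inj, ?_⟩⟩⟩
  intro P Q
  change T.Adj (f (r P)) (f (r Q)) ↔ _
  refine ⟨fun h => ?_, hom P Q⟩
  have hne : P ≠ Q := by
    rintro rfl
    exact T.irrefl _ h
  exact (B.check.complete P Q hne).resolve_right fun h' => T.asymm h (hom _ _ h')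

/-! ### Ramsey's theorem for pairs -/

/-- In a large set there is a large subset on which the colour of a pair depends only on its smaller
element. -/
theorem exists_endHomogeneous (κ : Type) [Finite κ] (n : ℕ) :
    ∃ N : ℕ, ∀ (col : ℕ → ℕ → κ) (S : Finset ℕ), N ≤ S.card →
      ∃ A ⊆ S, n ≤ A.card ∧ ∃ d : ℕ → κ, ∀ a ∈ A, ∀ b ∈ A, a < b → col a b = d a := by
  classical
  cases nonempty_fintype κ
  induction n with
  | zero => exact ⟨0, fun col S _ => ⟨∅, by simp, by simp, fun a => col a a, by simp⟩⟩
  | succ n ih =>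
    obtain ⟨N, hN⟩ := ih
    -- One element is spent on the minimum `m`; pigeonhole on the colours `col m b` then leaves at
    -- least `N` elements.
    refine ⟨Fintype.card κ * N + 1, fun col S hS => ?_⟩
    have hne : S.Nonempty := Finset.card_pos.1 (by omega)
    set m := S.min' hne
    have hm : m ∈ S := S.min'_mem hne
    have hcard : (S.erase m).card = S.card - 1 := Finset.card_erase_of_mem hm
    have : Nonempty κ := ⟨col 0 0⟩
    obtain ⟨k, -, hk⟩ := Finset.exists_le_card_fiber_of_mul_le_card_of_maps_to
      (s := S.erase m) (t := Finset.univ) (f := col m) (n := N) (fun _ _ => Finset.mem_univ _)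
      Finset.univ_nonempty (by rw [Finset.card_univ]; omega)
    obtain ⟨A, hAS, hA, d, hd⟩ := hN col _ hk
    have hA' : ∀ a ∈ A, a ∈ S ∧ m < a ∧ col m a = k := by
      intro a ha
      have h1 := Finset.mem_filter.1 (hAS ha)
      have h2 := Finset.mem_erase.1 h1.1
      exact ⟨h2.2, lt_of_le_of_ne (S.min'_le a h2.2) h2.1.symm, h1.2⟩
    have hmA : m ∉ A := fun h => lt_irrefl _ (hA' m h).2.1
    refine ⟨insert m A, ?_, ?_, Function.update d m k, ?_⟩
    · exact Finset.insert_subset hm fun a ha => (hA' a ha).1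
    · rw [Finset.card_insert_of_notMem hmA]
      omega
    · intro a ha b hb hab
      rcases Finset.mem_insert.1 ha with rfl | ha
      · rcases Finset.mem_insert.1 hb with rfl | hb
        · exact absurd hab (lt_irrefl _)
        · simpa using (hA' b hb).2.2
      · have hma := (hA' a ha).2.1
        rw [Function.update_of_ne hma.ne']
        rcases Finset.mem_insert.1 hb with rfl | hb
        · exact absurd hab (lt_asymm hma)
        · exact hd a ha b hb hab

/-- Pigeonhole on the end-colours `d` of an end-homogeneous set. The enumeration `g` is total on
`ℕ`, to avoid coercions from `Fin n`; its values from `n` on are irrelevant. -/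
theorem exists_homogeneous (κ : Type) [Finite κ] (n : ℕ) :
    ∃ N : ℕ, ∀ col : ℕ → ℕ → κ, ∃ g : ℕ → ℕ, (∀ i j, i < j → j < n → g i < g j) ∧
      (∀ i, i < n → g i < N) ∧ ∃ c, ∀ i j, i < j → j < n → col (g i) (g j) = c := by
  classical
  cases nonempty_fintype κ
  obtain ⟨N, hN⟩ := exists_endHomogeneous κ (Fintype.card κ * n)
  refine ⟨N, fun col => ?_⟩
  obtain ⟨A, hAS, hA, d, hd⟩ := hN col (Finset.range N) (by simp)
  have : Nonempty κ := ⟨col 0 0⟩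
  obtain ⟨k, -, hk⟩ := Finset.exists_le_card_fiber_of_mul_le_card_of_maps_to
    (s := A) (t := Finset.univ) (f := d) (n := n) (fun _ _ => Finset.mem_univ _)
    Finset.univ_nonempty (by rwa [Finset.card_univ])
  obtain ⟨A', hA', hcard⟩ := Finset.exists_subset_card_eq hk
  let e := A'.orderEmbOfFin hcard
  have he : ∀ i, e i ∈ A ∧ d (e i) = k := fun i =>
    Finset.mem_filter.1 (hA' (A'.orderEmbOfFin_mem hcard i))
  refine ⟨fun i => if h : i < n then e ⟨i, h⟩ else 0, ?_, ?_, k, ?_⟩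
  · intro i j hij hj
    simp only [hij.trans hj, hj, dif_pos]
    exact e.strictMono hij
  · intro i hi
    simp only [hi, dif_pos]
    exact Finset.mem_range.1 (hAS (he _).1)
  · intro i j hij hj
    simp only [hij.trans hj, hj, dif_pos]
    rw [hd _ (he _).1 _ (he _).1 (e.strictMono hij), (he _).2]

/-! ### Pairs of vertices in an acyclically indecomposable tournament -/

/-- `y → u → x`. -/
def ReturnWitness {V : Type u} (T : Tournament V) (x y u : V) : Prop :=
  T.Adj y u ∧ T.Adj u x

/-- A 3-cycle between `x` and `y`. -/
def CycleWitness {V : Type u} (T : Tournament V) (x y a b c : V) : Prop :=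
  (T.Adj x a ∧ T.Adj a y) ∧ (T.Adj x b ∧ T.Adj b y) ∧ (T.Adj x c ∧ T.Adj c y) ∧
    T.Adj a b ∧ T.Adj b c ∧ T.Adj c a

/-- A vertex `z` between `x` and `y` and a vertex `u` separating `z` from `x` and `y`. -/
def SplitWitness {V : Type u} (T : Tournament V) (x y z u : V) : Prop :=
  (T.Adj x z ∧ T.Adj z y) ∧ ((T.Adj z u ∧ T.Adj u x) ∨ (T.Adj y u ∧ T.Adj u z))

/-- Without return and split witnesses, the set `A` of `x`, `y` and everything between is
autonomous. Without cycle witnesses it is acyclic, since `x` is its source and `y` its sink, so a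
3-cycle in `A` avoids both. The three types share the variables `a b c`, and unused ones are
arbitrary. -/
theorem IsAcyclicallyIndecomposable.exists_witness {V : Type u} {T : Tournament V}
    (hT : T.IsAcyclicallyIndecomposable) {x y : V} (hxy : T.Adj x y) :
    ∃ a b c, T.ReturnWitness x y a ∨ T.CycleWitness x y a b c ∨ T.SplitWitness x y a b := by
  by_contra! hno
  have hR : ∀ u, T.Adj y u → ¬ T.Adj u x := fun u h h' => (hno u u u).1 ⟨h, h'⟩
  have hS : ∀ z u, T.Adj x z → T.Adj z y →
      (T.Adj z u → ¬ T.Adj u x) ∧ (T.Adj y u → ¬ T.Adj u z) := fun z u h h' =>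
    ⟨fun h1 h2 => (hno z u u).2.2 ⟨⟨h, h'⟩, Or.inl ⟨h1, h2⟩⟩,
      fun h1 h2 => (hno z u u).2.2 ⟨⟨h, h'⟩, Or.inr ⟨h1, h2⟩⟩⟩
  let A : Set V := {z | z = x ∨ z = y ∨ (T.Adj x z ∧ T.Adj z y)}
  have key : ∀ p ∈ A, ∀ w ∉ A, (T.Adj p w ↔ T.Adj x w) := by
    intro p hp w hw
    have hwx : w ≠ x := fun e => hw (Or.inl e)
    have hwy : w ≠ y := fun e => hw (Or.inr (Or.inl e))
    have hwi : T.Adj x w → ¬ T.Adj w y := fun h h' => hw (Or.inr (Or.inr ⟨h, h'⟩))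
    have hwp : w ≠ p := fun e => hw (e ▸ hp)
    have cx := T.complete w x hwx
    have cy := T.complete w y hwy
    have cp := T.complete w p hwp
    have ax : T.Adj w x → ¬ T.Adj x w := T.asymm
    have ap : T.Adj w p → ¬ T.Adj p w := T.asymm
    have rw' := hR w
    rcases hp with rfl | rfl | ⟨h1, h2⟩
    · exact Iff.rfl
    · tauto
    · have := hS p w h1 h2
      tauto
  have hx : x ∈ A := Or.inl rfl
  have hy : y ∈ A := Or.inr (Or.inl rfl)
  have hx' : ∀ z ∈ A, ¬ T.Adj z x := by
    rintro z (rfl | rfl | ⟨h, -⟩)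
    · exact T.irrefl _
    · exact T.asymm hxy
    · exact T.asymm h
  have hy' : ∀ z ∈ A, ¬ T.Adj y z := by
    rintro z (rfl | rfl | ⟨-, h⟩)
    · exact T.asymm hxy
    · exact T.irrefl _
    · exact T.asymm h
  -- A vertex on a cycle inside `A` has an in- and an out-neighbour there, so it is neither `x` nor
  -- `y`.
  have inner : ∀ p ∈ A, ∀ q ∈ A, ∀ r ∈ A, T.Adj p q → T.Adj r p → T.Adj x p ∧ T.Adj p y := by
    rintro p (rfl | rfl | h) q hq r hr h1 h2
    · exact absurd h2 (hx' r hr)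
    · exact absurd h1 (hy' q hq)
    · exact h
  have hsub := hT A (fun p hp q hq w hw => (key p hp w hw).trans (key q hq w hw).symm) (by
    rintro ⟨p, hp⟩ ⟨q, hq⟩ ⟨r, hr⟩ ⟨h1, h2, h3⟩
    exact (hno p q r).2.1 ⟨inner p hp q hq r hr h1 h3, inner q hq r hr p hp h2 h1,
      inner r hr p hp q hq h3 h2, h1, h2, h3⟩)
  have hxy' := hsub hx hy
  subst hxy'
  exact T.irrefl _ hxy

/-! ### Relations between sequences of vertices -/

section Sequences

variable {V : Type u} (T : Tournament V) (N : ℕ)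

/-- `p i → q i` for all `i < N`. -/
def Local (p q : ℕ → V) : Prop := ∀ i, i < N → T.Adj (p i) (q i)

/-- `p i → q j` for all `i < j < N`. -/
def Fwd (p q : ℕ → V) : Prop := ∀ i j, i < j → j < N → T.Adj (p i) (q j)

/-- `q j → p i` for all `i < j < N`. -/
def Bwd (p q : ℕ → V) : Prop := ∀ i j, i < j → j < N → T.Adj (q j) (p i)

/-- `p i → q j` for all `i, j < N`. -/
def Full (p q : ℕ → V) : Prop := ∀ i j, i < N → j < N → T.Adj (p i) (q j)

/-- `p 0 → q 0 → p 1 → q 1 → …` is an acyclic tournament ordered as listed. -/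
def Block (p q : ℕ → V) : Prop :=
  T.Local N p q ∧ T.Fwd N p p ∧ T.Fwd N q q ∧ T.Fwd N p q ∧ T.Fwd N q p

/-- In the family of sequences `w`, the relation between `w k i` and `w l j` for `i < j < N` depends
only on `k` and `l`. -/
def Homogeneous {ι : Type} (w : ι → ℕ → V) : Prop :=
  ∀ k l, T.Fwd N (w k) (w l) ∨ T.Bwd N (w k) (w l) ∨
    ∀ i j, i < j → j < N → w k i = w l j

/-- A member of `𝔅_n` maps to `T`, preserving edges. -/
def ContainsFamilyB (n : ℕ) : Prop :=
  ∃ B ∈ (linear n).familyB, ∃ f : B.1 → V, ∀ a b, B.2.Adj a b → T.Adj (f a) (f b)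

variable {T N} {n : ℕ}

theorem Local.rev {p q : ℕ → V} (h : T.Local N p q) :
    T.Local N (fun i => p (N - 1 - i)) fun i => q (N - 1 - i) :=
  fun i hi => h _ (by omega)

theorem Fwd.rev {p q : ℕ → V} (h : T.Fwd N p q) :
    T.Bwd N (fun i => q (N - 1 - i)) fun i => p (N - 1 - i) :=
  fun i j hij hj => h _ _ (by omega) (by omega)

theorem Bwd.rev {p q : ℕ → V} (h : T.Bwd N p q) :
    T.Fwd N (fun i => q (N - 1 - i)) fun i => p (N - 1 - i) :=
  fun i j hij hj => h _ _ (by omega) (by omega)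

theorem Fwd.not_bwd {p q : ℕ → V} (h : T.Fwd N p q) (hN : 2 ≤ N) : ¬ T.Bwd N p q :=
  fun h' => T.asymm (h 0 1 one_pos (by omega)) (h' 0 1 one_pos (by omega))

/-! ### Recognising the six tournaments in sequences of vertices -/

theorem containsFamilyB_of_delta {p q : ℕ → V} (hnN : n ≤ N) {X : Finset Pair} (hX : IsGood X)
    (hB : (⟨_, (linear n).deltaTournament X hX⟩ : Σ W : Type, Tournament W) ∈ (linear n).familyB)
    (h : ∀ i k l, i < N → ((0, k), (0, l)) ∈ X → T.Adj (![p i, q i] k) (![p i, q i] l))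
    (h' : ∀ i j k l, i < j → j < N →
      (((0, k), (1, l)) ∈ X → T.Adj (![p i, q i] k) (![p j, q j] l)) ∧
      (((1, l), (0, k)) ∈ X → T.Adj (![p j, q j] l) (![p i, q i] k))) :
    T.ContainsFamilyB n := by
  refine ⟨_, hB, fun a => ![p a.1, q a.1] a.2, ?_⟩
  rintro ⟨i, k⟩ ⟨j, l⟩ (⟨e, hk⟩ | ⟨e, hk⟩ | ⟨e, hk⟩)
  · obtain rfl : i = j := e
    exact h i k l (by omega) hk
  · exact (h' i j k l e (by omega)).1 hk
  · exact (h' j i l k e (by omega)).2 hk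

theorem containsFamilyB_of_T {p q : ℕ → V} (hnN : n ≤ N) (h : T.Local N p q) (hp : T.Fwd N p p)
    (hq : T.Fwd N q q) (hpq : T.Bwd N p q) (hqp : T.Bwd N q p) : T.ContainsFamilyB n := by
  refine containsFamilyB_of_delta (p := p) (q := q) hnN
    (X := {(d 0).swap, (d 1).swap, Tournament.h 1, Tournament.h 0, v 0}) (by decide)
    (by simp [familyB, TT]) ?_ ?_
  · intro i k l hi
    fin_cases k <;> fin_cases l <;> simp [d, v, Tournament.h]
    exact h i hi
  · intro i j k l hij hj
    fin_cases k <;> fin_cases l <;> simp [d, v, Tournament.h]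
    · exact hp i j hij hj
    · exact hpq i j hij hj
    · exact hqp i j hij hj
    · exact hq i j hij hj

theorem containsFamilyB_of_U {p q : ℕ → V} (hnN : n ≤ N) (h : T.Local N p q) (hp : T.Fwd N p p)
    (hq : T.Bwd N q q) (hpq : T.Fwd N p q) (hqp : T.Fwd N q p) : T.ContainsFamilyB n := by
  refine containsFamilyB_of_delta (p := p) (q := q) hnN
    (X := {d 0, d 1, (Tournament.h 1).swap, Tournament.h 0, v 0}) (by decide)
    (by simp [familyB, UT]) ?_ ?_
  · intro i k l hi
    fin_cases k <;> fin_cases l <;> simp [d, v, Tournament.h]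
    exact h i hi
  · intro i j k l hij hj
    fin_cases k <;> fin_cases l <;> simp [d, v, Tournament.h]
    · exact hp i j hij hj
    · exact hpq i j hij hj
    · exact hqp i j hij hj
    · exact hq i j hij hj

theorem containsFamilyB_of_H {p q : ℕ → V} (hnN : n ≤ N) (h : T.Local N p q) (hp : T.Fwd N p p)
    (hq : T.Fwd N q q) (hpq : T.Bwd N p q) (hqp : T.Fwd N q p) : T.ContainsFamilyB n := by
  refine containsFamilyB_of_delta (p := p) (q := q) hnN
    (X := {(d 0).swap, d 1, Tournament.h 1, Tournament.h 0, v 0}) (by decide)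
    (by simp [familyB, HT]) ?_ ?_
  · intro i k l hi
    fin_cases k <;> fin_cases l <;> simp [d, v, Tournament.h]
    exact h i hi
  · intro i j k l hij hj
    fin_cases k <;> fin_cases l <;> simp [d, v, Tournament.h]
    · exact hp i j hij hj
    · exact hpq i j hij hj
    · exact hqp i j hij hj
    · exact hq i j hij hj

theorem containsFamilyB_of_K {p q : ℕ → V} (hnN : n ≤ N) (h : T.Local N p q) (hp : T.Fwd N p p)
    (hq : T.Bwd N q q) (hpq : T.Bwd N p q) (hqp : T.Fwd N q p) : T.ContainsFamilyB n := by
  refine containsFamilyB_of_delta (p := p) (q := q) hnN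
    (X := {(d 0).swap, d 1, (Tournament.h 1).swap, Tournament.h 0, v 0}) (by decide)
    (by simp [familyB, KT]) ?_ ?_
  · intro i k l hi
    fin_cases k <;> fin_cases l <;> simp [d, v, Tournament.h]
    exact h i hi
  · intro i j k l hij hj
    fin_cases k <;> fin_cases l <;> simp [d, v, Tournament.h]
    · exact hp i j hij hj
    · exact hpq i j hij hj
    · exact hqp i j hij hj
    · exact hq i j hij hj

/-- The pairs `q (i + 1) → p i` form a copy of `U`. -/
theorem containsFamilyB_of_U_shift {p q : ℕ → V} (hnN : n + 1 ≤ N) (h : T.Local N p q)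
    (hp : T.Fwd N p p) (hq : T.Bwd N q q) (hpq : T.Bwd N p q) (hqp : T.Bwd N q p) :
    T.ContainsFamilyB n := by
  -- The order is reversed because `q` runs backwards. The shift uses index `n`, hence `n + 1 ≤ N`;
  -- for `j = i + 1` the last relation falls back on the local edge.
  refine containsFamilyB_of_U (p := fun i => q (n - i)) (q := fun i => p (n - 1 - i)) (N := n)
    le_rfl (fun i hi => hpq _ _ (by omega) (by omega))
    (fun i j hij hj => hq _ _ (by omega) (by omega))
    (fun i j hij hj => hp _ _ (by omega) (by omega))
    (fun i j hij hj => hpq _ _ (by omega) (by omega)) fun i j hij hj => ?_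
  rcases Nat.lt_or_ge (n - j) (n - 1 - i) with hij' | hij'
  · exact hqp _ _ hij' (by omega)
  · simpa only [show n - j = n - 1 - i by omega] using h (n - 1 - i) (by omega)

theorem containsFamilyB_of_V {x y : ℕ → V} {a : V} (hnN : n ≤ N) (h : T.Block N x y)
    (hx : ∀ i, i < N → T.Adj a (x i)) (hy : ∀ i, i < N → T.Adj (y i) a) :
    T.ContainsFamilyB n := by
  obtain ⟨h1, h2, h3, h4, h5⟩ := h
  refine ⟨⟨_, (linear n).VT⟩, by simp [familyB],
    fun s => s.elim a fun b => ![x b.1, y b.1] b.2, ?_⟩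
  rintro (_ | ⟨i, k⟩) (_ | ⟨j, l⟩) hab
  · exact hab.elim
  · obtain rfl : l = 0 := hab
    exact hx j (by omega)
  · obtain rfl : k = 1 := hab
    exact hy i (by omega)
  · rcases hab with hij | ⟨rfl, hkl⟩
    · have hij : i.1 < j.1 := hij
      have hj : j.1 < N := by omega
      fin_cases k <;> fin_cases l
      · exact h2 i j hij hj
      · exact h4 i j hij hj
      · exact h5 i j hij hj
      · exact h3 i j hij hj
    · fin_cases k <;> fin_cases l <;> simp at hkl
      exact h1 i (by omega)

theorem containsFamilyB_of_C3 {a b c : ℕ → V} (hnN : n ≤ N) (hab : T.Block N a b)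
    (hbc : T.Block N b c) (hca : T.Block N c a) : T.ContainsFamilyB n := by
  refine ⟨⟨_, (linear n).C3⟩, by simp [familyB], fun s => ![a s.1, b s.1, c s.1] s.2, ?_⟩
  rintro ⟨i, k⟩ ⟨j, l⟩ (hij | ⟨e, hkl⟩)
  · have hij : i.1 < j.1 := hij
    have hj : j.1 < N := by omega
    fin_cases k <;> fin_cases l
    · exact hab.2.1 i j hij hj
    · exact hab.2.2.2.1 i j hij hj
    · exact hca.2.2.2.2 i j hij hj
    · exact hab.2.2.2.2 i j hij hj
    · exact hab.2.2.1 i j hij hj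
    · exact hbc.2.2.2.1 i j hij hj
    · exact hca.2.2.2.1 i j hij hj
    · exact hbc.2.2.2.2 i j hij hj
    · exact hca.2.1 i j hij hj
  · obtain rfl : i = j := e
    obtain rfl : l = k + 1 := hkl
    have hi : i.1 < N := by omega
    fin_cases k
    · exact hab.1 i hi
    · exact hbc.1 i hi
    · exact hca.1 i hi

/-! ### The dichotomy between full and interleaved pairs of sequences -/

theorem Full.of_fwd_bwd {p q : ℕ → V} (h : T.Local N p q) (hpq : T.Fwd N p q)
    (hqp : T.Bwd N q p) : T.Full N p q := by
  intro i j hi hj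
  rcases lt_trichotomy i j with hij | rfl | hij
  · exact hpq i j hij hj
  · exact h i hi
  · exact hqp j i hij hi

theorem Full.rev {p q : ℕ → V}
    (h : T.Full N (fun i => p (N - 1 - i)) fun i => q (N - 1 - i)) : T.Full N p q := by
  intro i j hi hj
  have := h (N - 1 - i) (N - 1 - j) (by omega) (by omega)
  simpa only [show N - 1 - (N - 1 - i) = i by omega, show N - 1 - (N - 1 - j) = j by omega]
    using this

/-- With `p` increasing, the directions of `p`–`q`, `q`–`p` and `q`–`q` leave eight cases. Both
cross directions forward give `Block` or U; forward then backward gives `Full`; backward then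
forward gives H or K; both backward give T or the shifted U. -/
theorem full_or_block_of_fwd_left {p q : ℕ → V} (hnN : n + 1 ≤ N) (h : T.Local N p q)
    (hp : T.Fwd N p p) (hq : T.Fwd N q q ∨ T.Bwd N q q) (hpq : T.Fwd N p q ∨ T.Bwd N p q)
    (hqp : T.Fwd N q p ∨ T.Bwd N q p) :
    T.ContainsFamilyB n ∨ T.Full N p q ∨ T.Block N p q := by
  have hnN' : n ≤ N := by omega
  rcases hpq with hpq | hpq <;> rcases hqp with hqp | hqp
  · rcases hq with hq | hq
    · exact Or.inr (Or.inr ⟨h, hp, hq, hpq, hqp⟩)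
    · exact Or.inl (containsFamilyB_of_U hnN' h hp hq hpq hqp)
  · exact Or.inr (Or.inl (Full.of_fwd_bwd h hpq hqp))
  · rcases hq with hq | hq
    · exact Or.inl (containsFamilyB_of_H hnN' h hp hq hpq hqp)
    · exact Or.inl (containsFamilyB_of_K hnN' h hp hq hpq hqp)
  · rcases hq with hq | hq
    · exact Or.inl (containsFamilyB_of_T hnN' h hp hq hpq hqp)
    · exact Or.inl (containsFamilyB_of_U_shift hnN h hp hq hpq hqp)

/-- If `p` is decreasing, reversing the indices makes it increasing and `q` decreasing. `Full`
survives the reversal, and `Block` is then impossible. -/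
theorem full_or_block_of_fwd_right {p q : ℕ → V} (hnN : n + 2 ≤ N) (h : T.Local N p q)
    (hp : T.Fwd N p p ∨ T.Bwd N p p) (hq : T.Fwd N q q) (hpq : T.Fwd N p q ∨ T.Bwd N p q)
    (hqp : T.Fwd N q p ∨ T.Bwd N q p) :
    T.ContainsFamilyB n ∨ T.Full N p q ∨ T.Block N p q := by
  rcases hp with hp | hp
  · exact full_or_block_of_fwd_left (by omega) h hp (Or.inl hq) hpq hqp
  · rcases full_or_block_of_fwd_left (n := n) (by omega) h.rev hp.rev (Or.inr hq.rev)
      (hqp.symm.imp Bwd.rev Fwd.rev) (hpq.symm.imp Bwd.rev Fwd.rev) with h' | h' | h'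
    · exact Or.inl h'
    · exact Or.inr (Or.inl h'.rev)
    · exact absurd hq.rev (h'.2.2.1.not_bwd (by omega))

/-! ### Homogeneous families and the shapes of witnesses -/

variable {ι : Type} {w : ι → ℕ → V}

/-- In the equality alternative, `w l 1` and `w l 2` both equal `w k 0`, which a monotone `w l`
forbids; this is where three indices are needed. -/
theorem Homogeneous.fwd_or_bwd (hw : T.Homogeneous N w) (hN : 3 ≤ N) {k l : ι}
    (hl : T.Fwd N (w l) (w l) ∨ T.Bwd N (w l) (w l)) :
    T.Fwd N (w k) (w l) ∨ T.Bwd N (w k) (w l) := by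
  rcases hw k l with h | h | h
  · exact Or.inl h
  · exact Or.inr h
  · have e : w l 1 = w l 2 := (h 0 1 (by omega) (by omega)).symm.trans (h 0 2 (by omega) (by omega))
    rcases hl with hl | hl
    · have := hl 1 2 (by omega) (by omega)
      rw [e] at this
      exact absurd this (T.irrefl _)
    · have := hl 1 2 (by omega) (by omega)
      rw [e] at this
      exact absurd this (T.irrefl _)

theorem Homogeneous.monotone_or_const (hw : T.Homogeneous N w) (k : ι) :
    (T.Fwd N (w k) (w k) ∨ T.Bwd N (w k) (w k)) ∨ ∀ i, i < N → w k i = w k 0 := by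
  rcases hw k k with h | h | h
  · exact Or.inl (Or.inl h)
  · exact Or.inl (Or.inr h)
  · refine Or.inr fun i hi => ?_
    rcases Nat.eq_zero_or_pos i with rfl | h0
    · rfl
    · exact (h 0 i h0 hi).symm

theorem Homogeneous.full_or_block (hw : T.Homogeneous N w) (hN : n + 3 ≤ N) {k l : ι}
    (h : T.Local N (w k) (w l)) (hk : T.Fwd N (w k) (w k) ∨ T.Bwd N (w k) (w k))
    (hl : T.Fwd N (w l) (w l) ∨ T.Bwd N (w l) (w l))
    (hkl : T.Fwd N (w k) (w k) ∨ T.Fwd N (w l) (w l)) :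
    T.ContainsFamilyB n ∨ T.Full N (w k) (w l) ∨ T.Block N (w k) (w l) := by
  have h1 := hw.fwd_or_bwd (k := k) (by omega) hl
  have h2 := hw.fwd_or_bwd (k := l) (by omega) hk
  rcases hkl with hk' | hl'
  · exact full_or_block_of_fwd_left (by omega) h hk' hl h1 h2
  · exact full_or_block_of_fwd_right (by omega) h hk hl' h1 h2

/-- 3-cycles `x i → y i → u i → x i` over an acyclic `x 0 → y 0 → x 1 → y 1 → …`. -/
theorem Homogeneous.containsFamilyB_of_return (hw : T.Homogeneous N w) (hN : n + 3 ≤ N)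
    {x y u : ι} (h : T.Block N (w x) (w y)) (hyu : T.Local N (w y) (w u))
    (hux : T.Local N (w u) (w x)) : T.ContainsFamilyB n := by
  have hx := h.2.1
  have hy := h.2.2.1
  rcases hw.monotone_or_const u with hu | hu
  · rcases hw.full_or_block hN hux hu (Or.inl hx) (Or.inr hx) with h1 | h1 | h1
    · exact h1
    · rcases hw.full_or_block hN hyu (Or.inl hy) hu (Or.inl hy) with h2 | h2 | h2
      · exact h2
      · exact containsFamilyB_of_V (by omega) h (fun i hi => h1 0 i (by omega) hi)
          (fun i hi => h2 i 0 hi (by omega))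
      -- Interleaving puts every `y i` before the last `u`, so that one is the apex; in the mirrored
      -- case below it is the first `u`.
      · refine containsFamilyB_of_V (a := w u (N - 1)) (by omega) h
          (fun i hi => h1 (N - 1) i (by omega) hi) (fun i hi => ?_)
        rcases Nat.lt_or_ge i (N - 1) with hi' | hi'
        · exact h2.2.2.2.1 i (N - 1) hi' (by omega)
        · obtain rfl : i = N - 1 := by omega
          exact hyu _ hi
    · rcases hw.full_or_block hN hyu (Or.inl hy) hu (Or.inl hy) with h2 | h2 | h2
      · exact h2
      · refine containsFamilyB_of_V (a := w u 0) (by omega) h (fun i hi => ?_)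
          (fun i hi => h2 i 0 hi (by omega))
        rcases Nat.eq_zero_or_pos i with rfl | hi'
        · exact hux _ hi
        · exact h1.2.2.2.1 0 i hi' hi
      · exact containsFamilyB_of_C3 (by omega) h h2 h1
  · refine containsFamilyB_of_V (a := w u 0) (by omega) h (fun i hi => ?_) (fun i hi => ?_)
    · exact hu i hi ▸ hux i hi
    · exact hu i hi ▸ hyu i hi

/-- A vertex between `x i` and `y i`, for all `i`. -/
theorem containsFamilyB_of_between {x y : ℕ → V} {z : V} (hN : n + 1 ≤ N) (h : T.Block N x y)
    (hx : ∀ i, i < N → T.Adj (x i) z) (hy : ∀ i, i < N → T.Adj z (y i)) :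
    T.ContainsFamilyB n := by
  obtain ⟨h1, h2, h3, h4, h5⟩ := h
  -- The vertex `z` has the wrong orientation for an apex over the pairs `x i → y i`, but the right
  -- one over `y i → x (i + 1)`, at the cost of one index.
  refine containsFamilyB_of_V (x := y) (y := fun i => x (i + 1)) (a := z) (N := n) le_rfl
    ⟨?_, ?_, ?_, ?_, ?_⟩ (fun i hi => hy i (by omega)) (fun i hi => hx _ (by omega))
  · exact fun i hi => h5 _ _ (by omega) (by omega)
  · exact fun i j hij hj => h3 _ _ (by omega) (by omega)
  · exact fun i j hij hj => h2 _ _ (by omega) (by omega)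
  · exact fun i j hij hj => h5 _ _ (by omega) (by omega)
  · intro i j hij hj
    rcases Nat.lt_or_ge (i + 1) j with hij' | hij'
    · exact h4 _ _ hij' (by omega)
    · obtain rfl : i + 1 = j := by omega
      exact h1 _ (by omega)

/-- Vertices `z i` between `x i` and `y i` can be inserted into `x 0 → y 0 → x 1 → y 1 → …`. -/
theorem Homogeneous.block_of_between (hw : T.Homogeneous N w) (hN : n + 3 ≤ N)
    {x y z : ι} (h : T.Block N (w x) (w y)) (hxz : T.Local N (w x) (w z))
    (hzy : T.Local N (w z) (w y)) :
    T.ContainsFamilyB n ∨ (T.Block N (w x) (w z) ∧ T.Block N (w z) (w y)) := by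
  have hx := h.2.1
  have hy := h.2.2.1
  rcases hw.monotone_or_const z with hz | hz
  · rcases hw.full_or_block hN hxz (Or.inl hx) hz (Or.inl hx) with h1 | h1 | h1
    · exact Or.inl h1
    · rcases hw.full_or_block hN hzy hz (Or.inl hy) (Or.inr hy) with h2 | h2 | h2
      · exact Or.inl h2
      · exact Or.inl (containsFamilyB_of_between (by omega) h (fun i hi => h1 i 0 hi (by omega))
          (fun i hi => h2 0 i (by omega) hi))
      · refine Or.inl (containsFamilyB_of_between (z := w z 0) (by omega) h
          (fun i hi => h1 i 0 hi (by omega)) (fun i hi => ?_))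
        rcases Nat.eq_zero_or_pos i with rfl | hi'
        · exact hzy _ hi
        · exact h2.2.2.2.1 0 i hi' hi
    · rcases hw.full_or_block hN hzy hz (Or.inl hy) (Or.inr hy) with h2 | h2 | h2
      · exact Or.inl h2
      · refine Or.inl (containsFamilyB_of_between (z := w z (N - 1)) (by omega) h
          (fun i hi => ?_) (fun i hi => h2 (N - 1) i (by omega) hi))
        rcases Nat.lt_or_ge i (N - 1) with hi' | hi'
        · exact h1.2.2.2.1 i (N - 1) hi' (by omega)
        · obtain rfl : i = N - 1 := by omega
          exact hxz _ hi
      · exact Or.inr ⟨h1, h2⟩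
  · refine Or.inl (containsFamilyB_of_between (z := w z 0) (by omega) h (fun i hi => ?_)
      (fun i hi => ?_))
    · exact hz i hi ▸ hxz i hi
    · exact hz i hi ▸ hzy i hi

/-- Vertices `a i → b i` inserted between `x i` and `y i`, with a full edge set from `a` to `b`. -/
theorem containsFamilyB_of_full {a b y : ℕ → V} (hN : n + 1 ≤ N) (h : T.Full N a b)
    (hay : T.Block N a y) (hby : T.Block N b y) : T.ContainsFamilyB n := by
  -- The apex is `a n`: it dominates every `b i` by fullness, and every `y i` with `i < n` dominates
  -- it.
  obtain ⟨h1, h2, h3, h4, h5⟩ := hby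
  exact containsFamilyB_of_V (x := b) (y := y) (a := a n) (N := n) le_rfl
    ⟨fun i hi => h1 i (by omega), fun i j hij hj => h2 i j hij (by omega),
      fun i j hij hj => h3 i j hij (by omega), fun i j hij hj => h4 i j hij (by omega),
      fun i j hij hj => h5 i j hij (by omega)⟩
    (fun i hi => h n i (by omega) (by omega)) (fun i hi => hay.2.2.2.2 i n hi (by omega))

/-- 3-cycles `a i → b i → c i → a i` between `x i` and `y i`. -/
theorem Homogeneous.containsFamilyB_of_cycle (hw : T.Homogeneous N w) (hN : n + 3 ≤ N)
    {x y a b c : ι} (h : T.Block N (w x) (w y))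
    (ha : T.Local N (w x) (w a) ∧ T.Local N (w a) (w y))
    (hb : T.Local N (w x) (w b) ∧ T.Local N (w b) (w y))
    (hc : T.Local N (w x) (w c) ∧ T.Local N (w c) (w y))
    (hab : T.Local N (w a) (w b)) (hbc : T.Local N (w b) (w c)) (hca : T.Local N (w c) (w a)) :
    T.ContainsFamilyB n := by
  rcases hw.block_of_between hN h ha.1 ha.2 with h' | ⟨-, ha⟩
  · exact h'
  rcases hw.block_of_between hN h hb.1 hb.2 with h' | ⟨-, hb⟩
  · exact h'
  rcases hw.block_of_between hN h hc.1 hc.2 with h' | ⟨-, hc⟩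
  · exact h'
  have ha' := ha.2.1
  have hb' := hb.2.1
  have hc' := hc.2.1
  rcases hw.full_or_block hN hab (Or.inl ha') (Or.inl hb') (Or.inl ha') with h1 | h1 | h1
  · exact h1
  · exact containsFamilyB_of_full (by omega) h1 ha hb
  rcases hw.full_or_block hN hbc (Or.inl hb') (Or.inl hc') (Or.inl hb') with h2 | h2 | h2
  · exact h2
  · exact containsFamilyB_of_full (by omega) h2 hb hc
  rcases hw.full_or_block hN hca (Or.inl hc') (Or.inl ha') (Or.inl hc') with h3 | h3 | h3
  · exact h3
  · exact containsFamilyB_of_full (by omega) h3 hc ha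
  exact containsFamilyB_of_C3 (by omega) h1 h2 h3

end Sequences

/-! ### Extraction of homogeneous families -/

/-- The colour of a pair of indices records all adjacencies between the sequences. Two vertices with
no edge either way are equal, which gives the third alternative of `Homogeneous`. -/
theorem exists_homogeneous_family (ι κ : Type) [Finite ι] [Finite κ] (N : ℕ) :
    ∃ M : ℕ, ∀ {V : Type u} (T : Tournament V) (w : ι → ℕ → V) (t : ℕ → κ), ∃ g : ℕ → ℕ,
      (∀ i j, i < j → j < N → g i < g j) ∧ (∀ i, i < N → g i < M) ∧
      T.Homogeneous N (fun k i => w k (g i)) ∧ ∃ c, ∀ i, i < N → t (g i) = c := by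
  classical
  -- The pair colour also carries `t` of its smaller index; the extra index `N` makes every `i < N`
  -- the smaller element of a pair.
  obtain ⟨M, hM⟩ := exists_homogeneous ((ι → ι → Prop × Prop) × κ) (N + 1)
  refine ⟨M, fun T w t => ?_⟩
  obtain ⟨g, hg, hgM, ⟨r, c⟩, hc⟩ := hM fun i j =>
    (fun k l => (T.Adj (w k i) (w l j), T.Adj (w l j) (w k i)), t i)
  refine ⟨g, fun i j hij hj => hg i j hij (by omega), fun i hi => hgM i (by omega), ?_, c,
    fun i hi => congrArg Prod.snd (hc i N hi (by omega))⟩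
  intro k l
  have h1 : ∀ i j, i < j → j < N → (T.Adj (w k (g i)) (w l (g j))) = (r k l).1 :=
    fun i j hij hj => congrArg (fun s => (s.1 k l).1) (hc i j hij (by omega))
  have h2 : ∀ i j, i < j → j < N → (T.Adj (w l (g j)) (w k (g i))) = (r k l).2 :=
    fun i j hij hj => congrArg (fun s => (s.1 k l).2) (hc i j hij (by omega))
  by_cases hr1 : (r k l).1
  · exact Or.inl fun i j hij hj => (h1 i j hij hj).mpr hr1
  by_cases hr2 : (r k l).2
  · exact Or.inr (Or.inl fun i j hij hj => (h2 i j hij hj).mpr hr2)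
  refine Or.inr (Or.inr fun i j hij hj => ?_)
  by_contra hne
  rcases T.complete _ _ hne with h | h
  · exact hr1 ((h1 i j hij hj).mp h)
  · exact hr2 ((h2 i j hij hj).mp h)

/-- Large finite tournaments contain large acyclic ones. -/
theorem exists_chain (N : ℕ) : ∃ M : ℕ, ∀ (V : Type u) [Finite V] (T : Tournament V),
    M ≤ Nat.card V → ∃ c : ℕ → V, T.Fwd N c c := by
  -- Two extra indices ensure that 0 and 1 are available to exclude a constant sequence, `f` being
  -- injective below `Nat.card V`.
  obtain ⟨M, hM⟩ := exists_homogeneous_family Unit Unit (N + 2)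
  refine ⟨M + 1, fun V _ T hV => ?_⟩
  have e := Finite.equivFin V
  have : Nonempty V := ⟨e.symm ⟨0, by omega⟩⟩
  let f : ℕ → V := fun i => if hi : i < Nat.card V then e.symm ⟨i, hi⟩ else Classical.arbitrary V
  obtain ⟨g, hg, hgM, hw, -⟩ := hM T (fun _ : Unit => f) fun _ => ()
  rcases hw () () with h | h | h
  · exact ⟨_, fun i j hij hj => h i j hij (by omega)⟩
  · exact ⟨_, fun i j hij hj => h.rev i j hij (by omega)⟩
  · have h01 := h 0 1 one_pos (by omega)
    have h0 : g 0 < Nat.card V := by have := hgM 0 (by omega); omega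
    have h1 : g 1 < Nat.card V := by have := hgM 1 (by omega); omega
    simp only [f, h0, h1, dif_pos] at h01
    have := Fin.mk.inj_iff.1 (e.symm.injective h01)
    exact absurd this (hg 0 1 one_pos (by omega)).ne

/-! ### Assembling the proof -/

theorem exists_containsFamilyB (n : ℕ) : ∃ a : ℕ, ∀ (V : Type u) [Finite V] (T : Tournament V),
    a ≤ Nat.card V → T.IsAcyclicallyIndecomposable → T.ContainsFamilyB n := by
  obtain ⟨M, hM⟩ := exists_homogeneous_family (Fin 5) (Prop × Prop × Prop × Prop) (n + 3)
  obtain ⟨a, ha⟩ := exists_chain (2 * M + 2)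
  refine ⟨a, fun V _ T hV hT => ?_⟩
  obtain ⟨s, hs⟩ := ha V T hV
  have hwit : ∀ i, ∃ a b c, i < M → T.ReturnWitness (s (2 * i)) (s (2 * i + 1)) a ∨
      T.CycleWitness (s (2 * i)) (s (2 * i + 1)) a b c ∨
      T.SplitWitness (s (2 * i)) (s (2 * i + 1)) a b := by
    intro i
    by_cases hi : i < M
    · obtain ⟨a, b, c, h⟩ := hT.exists_witness (hs (2 * i) (2 * i + 1) (by omega) (by omega))
      exact ⟨a, b, c, fun _ => h⟩
    -- Filler values: no witness is claimed beyond `M`.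
    · exact ⟨s 0, s 0, s 0, fun h => absurd h hi⟩
  choose a b c hwit using hwit
  let w : Fin 5 → ℕ → V := ![fun i => s (2 * i), fun i => s (2 * i + 1), a, b, c]
  -- The last colour records which alternative of a split witness occurs, so that the same one can
  -- be used for all indices.
  obtain ⟨g, hg, hgM, hw, ⟨t₁, t₂, t₃, t₄⟩, ht⟩ := hM T w fun i =>
    (T.ReturnWitness (s (2 * i)) (s (2 * i + 1)) (a i),
      T.CycleWitness (s (2 * i)) (s (2 * i + 1)) (a i) (b i) (c i),
      T.SplitWitness (s (2 * i)) (s (2 * i + 1)) (a i) (b i),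
      T.Adj (a i) (b i) ∧ T.Adj (b i) (s (2 * i)))
  simp only [Prod.mk.injEq] at ht
  have hblock : T.Block (n + 3) (fun i => w 0 (g i)) (fun i => w 1 (g i)) := by
    refine ⟨fun i hi => ?_, fun i j hij hj => ?_, fun i j hij hj => ?_, fun i j hij hj => ?_,
      fun i j hij hj => ?_⟩
    · have := hgM i hi
      exact hs _ _ (by omega) (by omega)
    all_goals
      have h1 := hgM j hj
      have h2 := hg i j hij hj
      exact hs _ _ (by omega) (by omega)
  have h0 := hwit (g 0) (hgM 0 (by omega))
  have ht0 := ht 0 (by omega)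
  rw [ht0.1, ht0.2.1, ht0.2.2.1] at h0
  rcases h0 with h0 | h0 | h0
  · have hW := fun i hi => (ht i hi).1.mpr h0
    exact hw.containsFamilyB_of_return (x := 0) (y := 1) (u := 2) le_rfl hblock
      (fun i hi => (hW i hi).1) (fun i hi => (hW i hi).2)
  · have hW := fun i hi => (ht i hi).2.1.mpr h0
    exact hw.containsFamilyB_of_cycle (x := 0) (y := 1) (a := 2) (b := 3) (c := 4) le_rfl hblock
      ⟨fun i hi => (hW i hi).1.1, fun i hi => (hW i hi).1.2⟩
      ⟨fun i hi => (hW i hi).2.1.1, fun i hi => (hW i hi).2.1.2⟩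
      ⟨fun i hi => (hW i hi).2.2.1.1, fun i hi => (hW i hi).2.2.1.2⟩
      (fun i hi => (hW i hi).2.2.2.1) (fun i hi => (hW i hi).2.2.2.2.1)
      (fun i hi => (hW i hi).2.2.2.2.2)
  · have hW := fun i hi => (ht i hi).2.2.1.mpr h0
    rcases hw.block_of_between (x := 0) (y := 1) (z := 2) le_rfl hblock
      (fun i hi => (hW i hi).1.1) (fun i hi => (hW i hi).1.2) with h | ⟨hxz, hzy⟩
    · exact h
    -- Once `z` is interleaved, `u` closes 3-cycles over the pairs `(x, z)` or over the pairs `(z,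
    -- y)`, which reduces to the return case.
    by_cases h4 : t₄
    · have h4' := fun i hi => (ht i hi).2.2.2.mpr h4
      exact hw.containsFamilyB_of_return (x := 0) (y := 2) (u := 3) le_rfl hxz
        (fun i hi => (h4' i hi).1) (fun i hi => (h4' i hi).2)
    · have h4' := fun i hi => (hW i hi).2.resolve_left fun h => h4 ((ht i hi).2.2.2.mp h)
      exact hw.containsFamilyB_of_return (x := 2) (y := 1) (u := 3) le_rfl hzy
        (fun i hi => (h4' i hi).1) (fun i hi => (h4' i hi).2)

end Tournament

theorem theorem3 (n : ℕ) :
    ∃ a : ℕ, ∀ (V : Type u) [Finite V] (T : Tournament V),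
      a ≤ Nat.card V → T.IsAcyclicallyIndecomposable →
        ∃ B ∈ (Tournament.linear n).checkFamilyB, B.2.IsEmbeddableInto T := by
  obtain ⟨a, ha⟩ := Tournament.exists_containsFamilyB.{u} n
  refine ⟨a, fun V _ T hV hT => ?_⟩
  obtain ⟨B, hB, f, hf⟩ := ha V T hV hT
  exact ⟨_, ⟨B, hB, rfl⟩, Tournament.check_isEmbeddableInto_of_hom f hf⟩
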